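/- Let $G$ be an infinite countable discrete group acting by homeomorphisms on a compact metrizable space $M$. Assume that - the action is a convergence action: for every sequence $(g_n)$ of distinct elements of $G$ there are a subsequence $(g_{n_k})$ and points $a,b\in M$ such that, for every compact $K\subset M\setminus\{a\}$ and every open neighbourhood $U$ of $b$, one has $g_{n_k}(K)\subset U$ for all sufficiently large $k$; - the action is non-elementary: no $G$-invariant subset of $M$ consists of one or two points; - the action is minimal: the only closed $G$-invariant subsets of $M$ are $\emptyset$ and $M$. Let $T$ be the set of triples of pairwise distinct points of $M$, with the diagonal action of $G$. For $x\in T$ let $\tau_x$ be the topology on the disjoint union $G\cup M$ generated by all subsets of $G$ together with the sets $$\widetilde U_G=\{g\in G : \text{at least two components of } gx \text{ lie in } U\}\cup U,\qquad U\subset M \text{ open}.$$ Then $T\neq\emptyset$, and there is a topology $\tau$ on $G\cup M$, with $\tau=\tau_x$ for every $x\in T$, such that $(G\cup M,\tau)$ is compact and Hausdorff and the inclusions $G\hookrightarrow G\cup M$ and $M\hookrightarrow G\cup M$ are topological embeddings. Moreover, for every probability measure $\mu$ on $G$ whose support generates $G$ as a group, almost every sample path of the associated random walk converges in $(G\cup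 M,\tau)$ to a point of $M$; that is, for $\mu^{\mathbb N}$-almost every $(g_1,g_2,\dots)\in G^{\mathbb N}$, the sequence $w_n=g_1g_2\cdots g_n$ converges to some point of $M$. -/

import Mathlib

open Set Filter Topology MeasureTheory

/-- The action of `G` on `M` has the convergence property: every sequence of distinct elements of
`G` has a subsequence `g (φ k)` and points `a b : M` such that `g (φ k)` converges to `b`
uniformly on the compact subsets of `M \ {a}`. -/
def IsConvergenceAction (G M : Type*) [Group G] [TopologicalSpace M] [MulAction G M] : Prop :=
  ∀ g : ℕ → G, Function.Injective g →
    ∃ φ : ℕ → ℕ, StrictMono φ ∧ ∃ a b : M,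
      ∀ K : Set M, IsCompact K → K ⊆ {a}ᶜ → ∀ U : Set M, IsOpen U → b ∈ U →
        ∃ N : ℕ, ∀ k, N < k → ∀ x ∈ K, g (φ k) • x ∈ U

/-- There is no invariant subset of `M` that consists of one or two points. -/
def IsNonElementaryAction (G M : Type*) [Group G] [MulAction G M] : Prop :=
  ∀ s : Set M, s.ncard = 1 ∨ s.ncard = 2 → ¬ ∀ g : G, ∀ x ∈ s, g • x ∈ s

/-- The space of (ordered) triples of pairwise distinct points of `M`. -/
def DistinctTriples (M : Type*) : Type _ := {x : Fin 3 → M // Function.Injective x}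

/-- The subset `{g ∈ G | at least two components of g x lie in U} ∪ U` of `G ∪ M`, the disjoint
union of `G` and `M`. -/
def tildeSet (G : Type*) {M : Type*} [Group G] [MulAction G M]
    (x : DistinctTriples M) (U : Set M) : Set (G ⊕ M) :=
  Sum.inl '' {g : G | ∃ i j : Fin 3, i ≠ j ∧ g • x.1 i ∈ U ∧ g • x.1 j ∈ U} ∪ Sum.inr '' U

/-- The topology on `G ∪ M` generated by all subsets of `G` and all the sets `tildeSet G x U`
with `U ⊆ M` open. -/
@[reducible] def tripleTopology (G : Type*) {M : Type*} [Group G] [TopologicalSpace M] [MulAction G M]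
    (x : DistinctTriples M) : TopologicalSpace (G ⊕ M) :=
  TopologicalSpace.generateFrom
    ({s | ∃ A : Set G, s = Sum.inl '' A} ∪ {s | ∃ U : Set M, IsOpen U ∧ s = tildeSet G x U})

/-- The support of `μ` generates the group `G`. -/
def IsGeneratingMeasure {G : Type*} [Group G] [MeasurableSpace G] (μ : Measure G) : Prop :=
  Subgroup.closure {g : G | μ {g} ≠ 0} = ⊤

/-- The position `w n = ω 0 * ω 1 * ⋯ * ω (n - 1)` after `n` steps of the walk that starts at the
neutral element and has increments `ω 0, ω 1, …`. -/
def walk {G : Type*} [Group G] (ω : ℕ → G) : ℕ → G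
  | 0 => 1
  | n + 1 => walk ω n * ω n

/-! Topology. By the convergence property, any infinite subset of `G` contains distinct elements `h
k` sending every point except one point `a` to a limit `b`. At most one component of a triple equals
`a`, so two components are always attracted to `b`: this makes the topology independent of the
triple (`finite_pairSet_diff`) and compact (`compactSpace_tripleTopology`). It is Hausdorff because
two pairs of indices in `Fin 3` always meet.

Random walk. A `μ`-stationary probability `ν` on `M` exists (`exists_stationary`) and has no atoms
(`measure_singleton_of_stationary`). For `y` in `M`, the function `F_y(g) = ∫ dist (g • x) y ∂ν` is
bounded and harmonic, so `F_y(w_n)` converges almost surely by martingale convergence,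
simultaneously for all `y` in a countable dense set. Along a sequence of distinct positions
attracted to `b`, the limit is `dist b y`, since the exceptional point is `ν`-null. Hence all
attracting points coincide. Almost surely the walk takes infinitely many values
(`ae_infinite_range_walk`), so such a point exists, and it is the limit
(`exists_tendsto_inr_of_tendsto_integral_dist`). -/

/-! ### Combinatorics of triples. -/

/-- The elements `g` such that at least two components of `g • x` lie in `U`. -/
def pairSet (G : Type*) {M : Type*} [Group G] [MulAction G M]
    (x : DistinctTriples M) (U : Set M) : Set G :=
  {g : G | ∃ i j : Fin 3, i ≠ j ∧ g • x.1 i ∈ U ∧ g • x.1 j ∈ U}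

theorem DistinctTriples.exists_pair_ne {M : Type*} (x : DistinctTriples M) (a : M) :
    ∃ i j : Fin 3, i ≠ j ∧ x.1 i ≠ a ∧ x.1 j ≠ a := by
  by_cases h0 : x.1 0 = a
  · exact ⟨1, 2, by decide, fun h => absurd (x.2 (h.trans h0.symm)) (by decide),
      fun h => absurd (x.2 (h.trans h0.symm)) (by decide)⟩
  by_cases h1 : x.1 1 = a
  · exact ⟨0, 2, by decide, h0, fun h => absurd (x.2 (h.trans h1.symm)) (by decide)⟩
  exact ⟨0, 1, by decide, h0, h1⟩

theorem disjoint_pairSet {G M : Type*} [Group G] [MulAction G M]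
    (x : DistinctTriples M) {U V : Set M} (hUV : Disjoint U V) :
    Disjoint (pairSet G x U) (pairSet G x V) := by
  rw [Set.disjoint_left] at hUV ⊢
  rintro g ⟨i, j, hij, hi, hj⟩ ⟨k, l, hkl, hk, hl⟩
  have : k = i ∨ k = j ∨ l = i ∨ l = j := by omega
  rcases this with rfl | rfl | rfl | rfl
  · exact hUV hi hk
  · exact hUV hj hk
  · exact hUV hi hl
  · exact hUV hj hl

theorem pairSet_mono {G M : Type*} [Group G] [MulAction G M]
    (x : DistinctTriples M) {U V : Set M} (hUV : U ⊆ V) :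
    pairSet G x U ⊆ pairSet G x V := by
  rintro g ⟨i, j, hij, hi, hj⟩
  exact ⟨i, j, hij, hUV hi, hUV hj⟩

theorem nonempty_distinctTriples {M : Type*} [Infinite M] : Nonempty (DistinctTriples M) :=
  ⟨⟨fun i => Infinite.natEmbedding M i,
    (Infinite.natEmbedding M).injective.comp Fin.val_injective⟩⟩

@[simp] theorem inl_mem_tildeSet {G M : Type*} [Group G] [MulAction G M]
    {x : DistinctTriples M} {U : Set M} {g : G} :
    (Sum.inl g : G ⊕ M) ∈ tildeSet G x U ↔ g ∈ pairSet G x U := by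
  simp [tildeSet, pairSet]

@[simp] theorem inr_mem_tildeSet {G M : Type*} [Group G] [MulAction G M]
    {x : DistinctTriples M} {U : Set M} {p : M} :
    (Sum.inr p : G ⊕ M) ∈ tildeSet G x U ↔ p ∈ U := by
  simp [tildeSet]

/-! ### Consequences of the convergence property and of minimality. -/

section Convergence

variable {G M : Type*} [Group G] [TopologicalSpace M] [MulAction G M]

theorem IsConvergenceAction.exists_tendsto (hconv : IsConvergenceAction G M) {A : Set G}
    (hA : A.Infinite) :
    ∃ h : ℕ → G, Function.Injective h ∧ (∀ k, h k ∈ A) ∧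
      ∃ a b : M, ∀ x, x ≠ a → Tendsto (fun k => h k • x) atTop (𝓝 b) := by
  obtain ⟨φ, hφ, a, b, hab⟩ := hconv (fun n => (hA.natEmbedding A n : G))
    (Subtype.val_injective.comp (hA.natEmbedding A).injective)
  refine ⟨fun k => (hA.natEmbedding A (φ k) : G),
    (Subtype.val_injective.comp (hA.natEmbedding A).injective).comp hφ.injective,
    fun k => (hA.natEmbedding A (φ k)).2, a, b, fun x hx => ?_⟩
  rw [tendsto_nhds]
  intro U hU hbU
  obtain ⟨N, hN⟩ := hab {x} isCompact_singleton (by simpa using hx.symm) U hU hbU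
  filter_upwards [eventually_gt_atTop N] with k hk using hN k hk x rfl

theorem eventually_mem_pairSet {h : ℕ → G} {a b : M}
    (hab : ∀ x, x ≠ a → Tendsto (fun k => h k • x) atTop (𝓝 b)) (x : DistinctTriples M)
    {U : Set M} (hU : U ∈ 𝓝 b) : ∀ᶠ k in atTop, h k ∈ pairSet G x U := by
  obtain ⟨i, j, hij, hi, hj⟩ := x.exists_pair_ne a
  filter_upwards [(hab _ hi).eventually_mem hU, (hab _ hj).eventually_mem hU] with k h1 h2
  exact ⟨i, j, hij, h1, h2⟩

/-- An infinite difference would contain a sequence attracted to some `b`. Membership for `x` and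
`V` forces `b ∈ closure V ⊆ U`, and then the sequence eventually brings two components of `y` into
`U`. -/
theorem IsConvergenceAction.finite_pairSet_diff (hconv : IsConvergenceAction G M)
    (x y : DistinctTriples M) {U V : Set M} (hU : IsOpen U) (hVU : closure V ⊆ U) :
    (pairSet G x V \ pairSet G y U).Finite := by
  by_contra hinf
  obtain ⟨h, -, hmem, a, b, hab⟩ := hconv.exists_tendsto hinf
  have hb : b ∈ closure V := by
    rw [mem_closure_iff_nhds]
    intro W hW
    obtain ⟨k, hk⟩ := (eventually_mem_pairSet hab x hW).exists
    by_contra hne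
    exact (Set.disjoint_left.1 (disjoint_pairSet x (Set.disjoint_iff_inter_eq_empty.2
      (Set.not_nonempty_iff_eq_empty.1 hne)))) hk (hmem k).1
  obtain ⟨k, hk⟩ := (eventually_mem_pairSet hab y (hU.mem_nhds (hVU hb))).exists
  exact (hmem k).2 hk

/-- In a finite, hence discrete, `M` some injective `h k` would collapse any two points of `M \ {a}`
to `b`. So `M` would have at most two points and itself be a forbidden invariant set. -/
theorem IsConvergenceAction.infinite [Infinite G] [T1Space M] (hconv : IsConvergenceAction G M)
    (hne : IsNonElementaryAction G M) : Infinite M := by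
  by_contra hfin
  rw [not_infinite_iff_finite] at hfin
  obtain ⟨h, -, -, a, b, hab⟩ := hconv.exists_tendsto (Set.infinite_univ (α := G))
  have hsub : ∀ x ∈ ({a}ᶜ : Set M), ∀ y ∈ ({a}ᶜ : Set M), x = y := by
    intro x hx y hy
    have hb : {b} ∈ 𝓝 b := (isOpen_discrete {b}).mem_nhds rfl
    obtain ⟨k, h1, h2⟩ := (((hab x hx).eventually_mem hb).and ((hab y hy).eventually_mem hb)).exists
    exact MulAction.injective (h k) ((h1 : h k • x = b).trans (h2 : h k • y = b).symm)
  have h1 : ({a}ᶜ : Set M).ncard ≤ 1 := (Set.ncard_le_one (Set.toFinite _)).2 hsub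
  have h2 : ({a}ᶜ : Set M).ncard + 1 = (univ : Set M).ncard := by
    rw [← Set.ncard_insert_of_notMem (a := a) (by simp)]
    congr 1
    ext z
    simp [em]
  exact hne univ (by omega) fun _ _ _ => mem_univ _

theorem infinite_of_invariant [ContinuousConstSMul G M] [T1Space M] [Infinite M]
    (hmin : MulAction.IsMinimal G M) {A : Set M}
    (hA : ∀ g : G, ∀ x ∈ A, g • x ∈ A) (hne : A.Nonempty) : A.Infinite := by
  intro hfin
  obtain ⟨x, hx⟩ := hne
  have : (univ : Set M) ⊆ A := by
    rw [← (hmin.dense_orbit x).closure_eq]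
    exact closure_minimal (by rintro _ ⟨g, rfl⟩; exact hA g x hx) hfin.isClosed
  exact Set.infinite_univ (hfin.subset this)

end Convergence

/-! ### The topology on `G ∪ M`: Hausdorff, independent of the triple, compact. -/

section TripleTopology

variable {G M : Type*} [Group G] [TopologicalSpace M] [MulAction G M]

theorem isOpen_tildeSet (x : DistinctTriples M) {U : Set M} (hU : IsOpen U) :
    IsOpen[tripleTopology G x] (tildeSet G x U) :=
  TopologicalSpace.isOpen_generateFrom_of_mem (Or.inr ⟨U, hU, rfl⟩)

theorem isOpen_inl_image (x : DistinctTriples M) (A : Set G) :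
    IsOpen[tripleTopology G x] (Sum.inl '' A) :=
  TopologicalSpace.isOpen_generateFrom_of_mem (Or.inl ⟨A, rfl⟩)

theorem tendsto_nhds_inr_iff {α : Type*} {l : Filter α} {f : α → G ⊕ M} (x : DistinctTriples M)
    {p : M} : Tendsto f l (@nhds _ (tripleTopology G x) (Sum.inr p)) ↔
      ∀ U, IsOpen U → p ∈ U → ∀ᶠ t in l, f t ∈ tildeSet G x U := by
  rw [TopologicalSpace.tendsto_nhds_generateFrom_iff]
  constructor
  · intro h U hU hp
    exact h _ (Or.inr ⟨U, hU, rfl⟩) (by simpa using hp)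
  · rintro h s (⟨A, rfl⟩ | ⟨U, hU, rfl⟩) hs
    · simp at hs
    · exact h U hU (by simpa using hs)

theorem continuous_inr_tripleTopology (x : DistinctTriples M) :
    Continuous[_, tripleTopology G x] (Sum.inr : M → G ⊕ M) := by
  refine continuous_generateFrom_iff.2 ?_
  rintro s (⟨A, rfl⟩ | ⟨U, hU, rfl⟩)
  · convert isOpen_empty
    ext; simp
  · convert hU
    ext; simp

theorem t2Space_tripleTopology [T2Space M] (x : DistinctTriples M) :
    @T2Space (G ⊕ M) (tripleTopology G x) := by
  have key : ∀ (g : G) (p : M), ∃ u v : Set (G ⊕ M), IsOpen[tripleTopology G x] u ∧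
      IsOpen[tripleTopology G x] v ∧ Sum.inl g ∈ u ∧ Sum.inr p ∈ v ∧ Disjoint u v := by
    intro g p
    -- Two components of `g • x` differ from `p`; deleting them from `M` leaves a neighbourhood of
    -- `p` whose `tildeSet` misses `g`.
    obtain ⟨i, j, hij, hi, hj⟩ := x.exists_pair_ne (g⁻¹ • p)
    have hi' : p ≠ g • x.1 i := fun h => hi (by simp [h])
    have hj' : p ≠ g • x.1 j := fun h => hj (by simp [h])
    let U : Set M := {g • x.1 i, g • x.1 j}ᶜ
    have hU : IsOpen U := (Set.toFinite _).isClosed.isOpen_compl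
    refine ⟨Sum.inl '' {g}, tildeSet G x U, isOpen_inl_image x _, isOpen_tildeSet x hU,
      by simp, by simp [U, hi', hj'], ?_⟩
    rw [Set.image_singleton, Set.disjoint_singleton_left, inl_mem_tildeSet]
    exact Set.disjoint_left.1 (disjoint_pairSet x (disjoint_compl_right (a := Uᶜ)) |>.mono_right
      (pairSet_mono x (by simp))) ⟨i, j, hij, by simp [U], by simp [U]⟩
  refine @T2Space.mk _ (tripleTopology G x) ?_
  rintro (g | p) (h | q) hne
  · refine ⟨_, _, isOpen_inl_image x {g}, isOpen_inl_image x {h}, by simp, by simp, ?_⟩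
    simpa using fun e => hne (by rw [e])
  · exact key g q
  · obtain ⟨u, v, hu, hv, h1, h2, h3⟩ := key h p
    exact ⟨v, u, hv, hu, h2, h1, h3.symm⟩
  · obtain ⟨U, V, hU, hV, hp, hq, hd⟩ := t2_separation (fun e => hne (by rw [e]) : p ≠ q)
    refine ⟨_, _, isOpen_tildeSet x hU, isOpen_tildeSet x hV, by simpa, by simpa, ?_⟩
    rw [Set.disjoint_left]
    rintro (k | r) h1 h2
    · exact Set.disjoint_left.1 (disjoint_pairSet x hd) (by simpa using h1) (by simpa using h2)
    · exact Set.disjoint_left.1 hd (by simpa using h1) (by simpa using h2)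

theorem tripleTopology_le [CompactSpace M] [T2Space M] (hconv : IsConvergenceAction G M)
    (x y : DistinctTriples M) : tripleTopology G x ≤ tripleTopology G y := by
  refine le_generateFrom ?_
  rintro s (⟨A, rfl⟩ | ⟨U, hU, rfl⟩)
  · exact isOpen_inl_image x A
  let := tripleTopology G x
  have := t2Space_tripleTopology (G := G) x
  rw [isOpen_iff_forall_mem_open]
  rintro (g | p) hp
  · exact ⟨Sum.inl '' {g}, by simpa using hp, isOpen_inl_image x _, by simp⟩
  · obtain ⟨V, hV, hpV, hVU⟩ := exists_mem_nhds_isClosed_subset (hU.mem_nhds (by simpa using hp))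
    have hfin := hconv.finite_pairSet_diff x y (V := interior V) hU
      ((closure_minimal interior_subset hpV).trans hVU)
    -- Only finitely many group elements violate the inclusion; they form a closed set by the
    -- Hausdorff property and can be removed.
    refine ⟨tildeSet G x (interior V) \ Sum.inl '' (pairSet G x (interior V) \ pairSet G y U),
      ?_, (isOpen_tildeSet x isOpen_interior).sdiff (hfin.image _).isClosed,
      by simpa using mem_interior_iff_mem_nhds.2 hV⟩
    rintro (k | r)
    · simp; tauto
    · simpa using fun hr => hVU (interior_subset hr)

theorem compactSpace_tripleTopology [CompactSpace M] [T2Space M] (hconv : IsConvergenceAction G M)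
    (x : DistinctTriples M) : @CompactSpace (G ⊕ M) (tripleTopology G x) := by
  let := tripleTopology G x
  refine ⟨isCompact_iff_ultrafilter_le_nhds.2 fun F _ => ?_⟩
  have hcov : (range (Sum.inl : G → G ⊕ M)) ∪ range (Sum.inr : M → G ⊕ M) ∈ F := by
    rw [range_inl_union_range_inr]; exact univ_mem
  rcases Ultrafilter.union_mem_iff.1 hcov with hF | hF
  · obtain ⟨𝒰, rfl⟩ : ∃ 𝒰 : Ultrafilter G, 𝒰.map Sum.inl = F :=
      ⟨F.comap Sum.inl_injective hF, Ultrafilter.coe_injective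
        (by rw [Ultrafilter.coe_map, Ultrafilter.coe_comap, Filter.map_comap_of_mem hF])⟩
    by_cases hprin : ∃ s ∈ 𝒰, s.Finite
    · obtain ⟨s, hs, hsf⟩ := hprin
      obtain ⟨g, -, rfl⟩ := Ultrafilter.eq_pure_of_finite_mem hsf hs
      exact ⟨Sum.inl g, mem_univ _, by simpa using pure_le_nhds _⟩
    push Not at hprin
    have hlim : ∀ i, ∃ p : M, Tendsto (fun g : G => g • x.1 i) 𝒰 (𝓝 p) := fun i =>
      let ⟨p, _, hp⟩ := isCompact_univ.ultrafilter_le_nhds (𝒰.map fun g : G => g • x.1 i) (by simp)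
      ⟨p, hp⟩
    choose p hp using hlim
    -- Were the three limits distinct, closed neighbourhoods inside disjoint open sets would confine
    -- each component for an infinite set of `g`. An attracted sequence in that set sends two
    -- components to the same `b`, which would lie in two disjoint sets.
    obtain ⟨i, j, hij, hpij⟩ : ∃ i j, i ≠ j ∧ p i = p j := by
      by_contra! hinj
      have hinj' : Function.Injective p := fun i j h => by_contra fun hij => hinj i j hij h
      obtain ⟨U, hU, hdisj⟩ := (Set.finite_range p).t2_separation
      choose V hV hVc hVU using fun i =>
        exists_mem_nhds_isClosed_subset ((hU (p i)).2.mem_nhds (hU (p i)).1)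
      have hmem : {g : G | ∀ i, g • x.1 i ∈ V i} ∈ 𝒰 :=
        eventually_all.2 fun i => (hp i).eventually_mem (hV i)
      obtain ⟨h, -, hh, a, b, hab⟩ := hconv.exists_tendsto (hprin _ hmem)
      obtain ⟨i, j, hij, hi, hj⟩ := x.exists_pair_ne a
      have hbV : ∀ i, x.1 i ≠ a → b ∈ U (p i) := fun i hi =>
        hVU i ((hVc i).mem_of_tendsto (hab _ hi) (Eventually.of_forall fun k => hh k i))
      exact Set.disjoint_left.1 (hdisj (mem_range_self i) (mem_range_self j) (hinj i j hij))
        (hbV i hi) (hbV j hj)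
    refine ⟨Sum.inr (p i), mem_univ _, ?_⟩
    rw [Ultrafilter.coe_map]
    refine (tendsto_nhds_inr_iff x).2 fun U hU hpU => ?_
    filter_upwards [(hp i).eventually_mem (hU.mem_nhds hpU),
      (hp j).eventually_mem (hU.mem_nhds (hpij ▸ hpU))] with g h1 h2
    exact inl_mem_tildeSet.2 ⟨i, j, hij, h1, h2⟩
  · obtain ⟨𝒰, rfl⟩ : ∃ 𝒰 : Ultrafilter M, 𝒰.map Sum.inr = F :=
      ⟨F.comap Sum.inr_injective hF, Ultrafilter.coe_injective
        (by rw [Ultrafilter.coe_map, Ultrafilter.coe_comap, Filter.map_comap_of_mem hF])⟩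
    obtain ⟨p, -, hp⟩ := isCompact_univ.ultrafilter_le_nhds 𝒰 (by simp)
    exact ⟨Sum.inr p, mem_univ _,
      ((continuous_inr_tripleTopology x).tendsto p).mono_left hp⟩

end TripleTopology

/-! ### Stationary measures on `M`. -/

section Stationary

variable {G M : Type*} [Group G] [Countable G] [MeasurableSpace G] [DiscreteMeasurableSpace G]
  [TopologicalSpace M] [MeasurableSpace M] [BorelSpace M] [MulAction G M] [ContinuousConstSMul G M]

/-- The convolution of a measure on `G` with a measure on `M`. -/
noncomputable def convAction {G M : Type*} [Group G] [MulAction G M] [MeasurableSpace G]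
    [MeasurableSpace M] (μ : Measure G) (ν : Measure M) : Measure M :=
  (μ.prod ν).map fun p : G × M => p.1 • p.2

theorem measurable_smul_prod : Measurable fun p : G × M => p.1 • p.2 :=
  measurable_from_prod_countable_right fun g => (continuous_const_smul g).measurable

instance isProbabilityMeasure_convAction (μ : Measure G) (ν : Measure M) [IsProbabilityMeasure μ]
    [IsProbabilityMeasure ν] : IsProbabilityMeasure (convAction μ ν) :=
  Measure.isProbabilityMeasure_map measurable_smul_prod.aemeasurable

open BoundedContinuousFunction in
theorem integrable_boundedContinuousFunction_smul (μ : Measure G) (ν : Measure M)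
    [IsProbabilityMeasure μ] [IsProbabilityMeasure ν] (f : M →ᵇ ℝ) :
    Integrable (fun p : G × M => f (p.1 • p.2)) (μ.prod ν) :=
  Integrable.of_bound (f.continuous.measurable.comp measurable_smul_prod).aestronglyMeasurable ‖f‖
    (Eventually.of_forall fun _ => f.norm_coe_le_norm _)

open BoundedContinuousFunction in
theorem integral_convAction (μ : Measure G) (ν : Measure M)
    [IsProbabilityMeasure μ] [IsProbabilityMeasure ν] (f : M →ᵇ ℝ) :
    ∫ x, f x ∂(convAction μ ν) = ∫ x, ∫ g, f (g • x) ∂μ ∂ν := by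
  rw [convAction, integral_map measurable_smul_prod.aemeasurable
    f.continuous.measurable.aestronglyMeasurable]
  exact integral_prod_symm _ (integrable_boundedContinuousFunction_smul μ ν f)

open BoundedContinuousFunction in
/-- The Markov operator of `μ` on bounded continuous functions. -/
noncomputable def markovOp [FirstCountableTopology M] (μ : Measure G) [IsProbabilityMeasure μ]
    (f : M →ᵇ ℝ) : M →ᵇ ℝ :=
  BoundedContinuousFunction.ofNormedAddCommGroup (fun x => ∫ g, f (g • x) ∂μ)
    (continuous_of_dominated (F := fun x g => f (g • x)) (bound := fun _ => ‖f‖)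
      (fun _ => (measurable_of_countable _).aestronglyMeasurable)
      (fun _ => Eventually.of_forall fun _ => f.norm_coe_le_norm _)
      (integrable_const _)
      (Eventually.of_forall fun g => f.continuous.comp (continuous_const_smul g)))
    ‖f‖ (fun x => by
      simpa using norm_integral_le_of_norm_le_const (μ := μ) (f := fun g => f (g • x))
        (Eventually.of_forall fun _ => f.norm_coe_le_norm _))

theorem tendsto_cesaro_sub_shift {a : ℕ → ℝ} {C : ℝ} (ha : ∀ n, |a n| ≤ C) :
    Tendsto (fun n : ℕ => ((n : ℝ) + 1)⁻¹ * ∑ k ∈ Finset.range (n + 1), a (k + 1) -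
      ((n : ℝ) + 1)⁻¹ * ∑ k ∈ Finset.range (n + 1), a k) atTop (𝓝 0) := by
  have h : ∀ n : ℕ, ((n : ℝ) + 1)⁻¹ * ∑ k ∈ Finset.range (n + 1), a (k + 1) -
      ((n : ℝ) + 1)⁻¹ * ∑ k ∈ Finset.range (n + 1), a k = (a (n + 1) - a 0) * (1 / ((n : ℝ) + 1)) := by
    intro n
    rw [← mul_sub, ← Finset.sum_sub_distrib, Finset.sum_range_sub, one_div, mul_comm]
  simp_rw [h]
  refine bdd_le_mul_tendsto_zero' (2 * C) (Eventually.of_forall fun n => ?_)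
    tendsto_one_div_add_atTop_nhds_zero_nat
  exact (abs_sub _ _).trans (by linarith [ha (n + 1), ha 0])

/-- Krylov–Bogolyubov: a weak limit of the Cesàro averages of the iterated convolutions of a Dirac
mass, along an ultrafilter finer than `atTop`. Applying `μ` changes an average only by a telescoping
term that vanishes in the limit. -/
theorem exists_stationary [CompactSpace M] [TopologicalSpace.MetrizableSpace M] [Nonempty M]
    (μ : Measure G) [IsProbabilityMeasure μ] :
    ∃ ν : Measure M, IsProbabilityMeasure ν ∧ convAction μ ν = ν := by
  obtain ⟨x₀⟩ := ‹Nonempty M›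
  let ρ : ℕ → Measure M := fun k => (convAction μ)^[k] (Measure.dirac x₀)
  have hρs : ∀ k, ρ (k + 1) = convAction μ (ρ k) := fun k => Function.iterate_succ_apply' _ _ _
  have hρ : ∀ k, IsProbabilityMeasure (ρ k) := by
    intro k
    induction k with
    | zero => exact Measure.dirac.isProbabilityMeasure
    | succ k ih => rw [hρs]; infer_instance
  let c : ℕ → Measure M := fun n =>
    ENNReal.ofReal (((n : ℝ) + 1)⁻¹) • ∑ k ∈ Finset.range (n + 1), ρ k
  have hc : ∀ n, IsProbabilityMeasure (c n) := by
    intro n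
    refine ⟨?_⟩
    simp only [c, Measure.smul_apply, Measure.finsetSum_apply, measure_univ, smul_eq_mul,
      Finset.sum_const, Finset.card_range, nsmul_eq_mul, mul_one]
    rw [← ENNReal.ofReal_natCast, ← ENNReal.ofReal_mul (by positivity)]
    push_cast
    rw [inv_mul_cancel₀ (by positivity), ENNReal.ofReal_one]
  have hint : ∀ n (f : BoundedContinuousFunction M ℝ), ∫ x, f x ∂(c n) =
      ((n : ℝ) + 1)⁻¹ * ∑ k ∈ Finset.range (n + 1), ∫ x, f x ∂(ρ k) := by
    intro n f
    rw [integral_smul_measure, integral_finsetSum_measure fun k _ => f.integrable _,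
      ENNReal.toReal_ofReal (by positivity), smul_eq_mul]
  let cP : ℕ → ProbabilityMeasure M := fun n => ⟨c n, hc n⟩
  let F : Ultrafilter ℕ := Ultrafilter.of atTop
  obtain ⟨ν, -, hν⟩ := isCompact_univ.ultrafilter_le_nhds (F.map cP) (by simp)
  have hν' := ProbabilityMeasure.tendsto_iff_forall_integral_tendsto.1
    (show Tendsto cP F (𝓝 ν) from hν)
  refine ⟨ν, inferInstance, ext_of_forall_integral_eq_of_IsFiniteMeasure fun f => ?_⟩
  rw [integral_convAction]
  have h1 := (hν' (markovOp μ f)).sub (hν' f)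
  refine sub_eq_zero.1 (tendsto_nhds_unique h1 ?_)
  refine Tendsto.congr (fun n => ?_) ((tendsto_cesaro_sub_shift (a := fun k => ∫ x, f x ∂(ρ k))
    (C := ‖f‖) fun k => ?_).mono_left (Ultrafilter.of_le atTop))
  · change _ = ∫ x, markovOp μ f x ∂(c n) - ∫ x, f x ∂(c n)
    rw [hint, hint]
    congr! 3 with k
    rw [hρs, integral_convAction]
    rfl
  · simpa using norm_integral_le_of_norm_le_const (μ := ρ k)
      (Eventually.of_forall fun x => f.norm_coe_le_norm x)

theorem convAction_singleton [MeasurableSingletonClass M] (μ : Measure G) (ν : Measure M)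
    [IsProbabilityMeasure ν] (y : M) : convAction μ ν {y} = ∫⁻ g, ν {g⁻¹ • y} ∂μ := by
  rw [convAction, Measure.map_apply measurable_smul_prod (measurableSet_singleton y),
    Measure.prod_apply (measurable_smul_prod (measurableSet_singleton y))]
  congr! 3 with g
  ext z
  simp [eq_inv_smul_iff]

/-- Maximum principle: the atoms of maximal mass form a finite set `A`. The maximal mass is a
`μ`-average of masses of atoms, so all of these are maximal and `g⁻¹` preserves `A` for `g` in the
support. Finiteness upgrades this to invariance under `G`, which minimality excludes. -/
theorem measure_singleton_of_stationary [T1Space M] [Infinite M] (hmin : MulAction.IsMinimal G M)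
    {μ : Measure G} [IsProbabilityMeasure μ] (hμ : IsGeneratingMeasure μ)
    {ν : Measure M} [IsProbabilityMeasure ν] (hν : convAction μ ν = ν) : ∀ x, ν {x} = 0 := by
  refine fun x₀ => by_contra fun hx₀ => ?_
  have hfin : ∀ c : ENNReal, c ≠ 0 → {y | c ≤ ν {y}}.Finite := fun c hc =>
    Measure.finite_const_le_meas_of_disjoint_iUnion ν (pos_iff_ne_zero.2 hc)
      (fun y => measurableSet_singleton y)
      (fun y z hyz => Set.disjoint_singleton.2 hyz) (measure_ne_top ν _)
  obtain ⟨y₀, hy₀, hmax⟩ := (hfin _ hx₀).exists_maximalFor (fun y => ν {y}) _ ⟨x₀, by simp⟩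
  have hle : ∀ y, ν {y} ≤ ν {y₀} := by
    intro y
    rcases le_total (ν {y}) (ν {y₀}) with h | h
    · exact h
    · exact hmax (hy₀.trans h) h
  let A : Set M := {y | ν {y} = ν {y₀}}
  have hA : A.Finite := (hfin (ν {y₀}) fun h => hx₀ (nonpos_iff_eq_zero.1 (h ▸ hle x₀))).subset
    fun y (hy : _ = _) => hy.ge
  have hsupp : ∀ g, μ {g} ≠ 0 → ∀ y ∈ A, g⁻¹ • y ∈ A := by
    intro g hg y hy
    have hst : ∫⁻ g, ν {g⁻¹ • y} ∂μ = ν {y₀} := by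
      rw [← convAction_singleton, hν]; exact hy
    have hae : (fun g : G => ν {g⁻¹ • y}) =ᵐ[μ] fun _ => ν {y₀} :=
      ae_eq_of_ae_le_of_lintegral_le (Eventually.of_forall fun g => hle _)
        (hst ▸ measure_ne_top ν _) aemeasurable_const (by simp [hst])
    by_contra hcon
    exact hg (measure_mono_null (by simpa [A] using hcon) hae)
  have hiff : ∀ g : G, ∀ y, g • y ∈ A ↔ y ∈ A := by
    intro g
    have hg : g ∈ Subgroup.closure {g : G | μ {g} ≠ 0} := by
      rw [show Subgroup.closure {g : G | μ {g} ≠ 0} = ⊤ from hμ]; trivial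
    induction hg using Subgroup.closure_induction with
    | mem g hg =>
      intro y
      refine ⟨fun h => by simpa using hsupp g hg _ h, fun h => ?_⟩
      have himg : (fun z => g⁻¹ • z) '' A = A :=
        Set.eq_of_subset_of_ncard_le (by rintro _ ⟨z, hz, rfl⟩; exact hsupp g hg z hz)
          (Set.ncard_image_of_injective _ (MulAction.injective g⁻¹)).ge hA
      rw [← himg] at h
      obtain ⟨z, hz, rfl⟩ := h
      simpa using hz
    | one => simp
    | mul g h _ _ ihg ihh => intro y; rw [mul_smul, ihg, ihh]
    | inv g _ ih => intro y; rw [← ih, smul_inv_smul]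
  exact infinite_of_invariant hmin (A := A) (fun g y hy => (hiff g y).2 hy) ⟨y₀, rfl⟩ hA

end Stationary

/-! ### Random walk: independence, infinite range, martingales. -/

open ProbabilityTheory in
theorem map_frestrictLe_prod_eval {G : Type*} [MeasurableSpace G] (μ : Measure G) [IsProbabilityMeasure μ] (n : ℕ) :
    (Measure.infinitePi fun _ : ℕ => μ).map
      (fun ω : ℕ → G => ((Preorder.frestrictLe n ω : Finset.Iic n → G), ω (n + 1))) =
    ((Measure.infinitePi fun _ : ℕ => μ).map (Preorder.frestrictLe n)).prod μ := by
  have hind : iIndepFun (fun (i : ℕ) (ω : ℕ → G) => ω i) (Measure.infinitePi fun _ : ℕ => μ) :=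
    iIndepFun_infinitePi (X := fun _ g => g) fun _ => measurable_id
  have h2 := hind.indepFun_finset (Finset.Iic n) {n + 1} (by simp) fun i => measurable_pi_apply i
  have hψ : Measurable fun v : ({n + 1} : Finset ℕ) → G => v ⟨n + 1, by simp⟩ :=
    measurable_pi_apply _
  have h3 : IndepFun (Preorder.frestrictLe n : (ℕ → G) → Finset.Iic n → G)
      (fun ω : ℕ → G => ω (n + 1)) (Measure.infinitePi fun _ : ℕ => μ) :=
    h2.comp measurable_id hψ
  have h4 := (indepFun_iff_map_prod_eq_prod_map_map (by fun_prop)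
    (measurable_pi_apply _).aemeasurable).1 h3
  have h5 : (Measure.infinitePi fun _ : ℕ => μ).map (fun ω : ℕ → G => ω (n + 1)) = μ :=
    Measure.infinitePi_map_eval (fun _ : ℕ => μ) (n + 1)
  exact h4.trans (congrArg _ h5)

section Walk

variable {G : Type*} [Group G]

theorem walk_add (ω : ℕ → G) (m k : ℕ) :
    walk ω (m + k) = walk ω m * walk (fun n => ω (m + n)) k := by
  induction k with
  | zero => simp [walk]
  | succ k ih => rw [← add_assoc, walk, walk, ih, mul_assoc]

theorem walk_congr {ω ω' : ℕ → G} {k : ℕ} (h : ∀ n < k, ω n = ω' n) : walk ω k = walk ω' k := by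
  induction k with
  | zero => rfl
  | succ k ih => rw [walk, walk, ih fun n hn => h n (by omega), h k (by omega)]

theorem exists_walk_eq_of_mem_closure {A : Set G} {h : G} (hh : h ∈ Submonoid.closure A) :
    ∃ (u : ℕ → G) (L : ℕ), (∀ n < L, u n ∈ A) ∧ walk u L = h := by
  induction hh using Submonoid.closure_induction_right with
  | one => exact ⟨fun _ => 1, 0, by simp, rfl⟩
  | mul_right x _ y hy ih =>
    obtain ⟨u, L, hu, rfl⟩ := ih
    refine ⟨Function.update u L y, L + 1, fun n hn => ?_, ?_⟩
    · rcases Nat.lt_succ_iff_lt_or_eq.1 hn with h | rfl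
      · rw [Function.update_of_ne h.ne]; exact hu n h
      · rwa [Function.update_self]
    · rw [walk, Function.update_self]
      congr 1
      exact walk_congr fun n hn => Function.update_of_ne hn.ne _ _

/-- If the submonoid were finite, all generators would have finite order, so it would already
contain inverses and equal `G`. -/
theorem infinite_submonoid_closure [Infinite G] {A : Set G} (hA : Subgroup.closure A = ⊤) :
    (Submonoid.closure A : Set G).Infinite := by
  intro hfin
  have hord : ∀ x ∈ A, IsOfFinOrder x := fun x hx => by
    refine finite_powers.1 (hfin.subset ?_)
    exact SetLike.coe_subset_coe.2 (Submonoid.powers_le.2 (Submonoid.subset_closure hx))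
  have htop : (Submonoid.closure A) = ⊤ := by
    rw [← Subgroup.closure_toSubmonoid_of_isOfFinOrder hord, hA]; rfl
  rw [htop] at hfin
  exact Set.infinite_univ hfin

/-- Extends a finite sequence by `1`. -/
def extendOne (n : ℕ) (v : Finset.Iic n → G) : ℕ → G :=
  fun k => if hk : k ∈ Finset.Iic n then v ⟨k, hk⟩ else 1

theorem measurable_extendOne [MeasurableSpace G] (n : ℕ) : Measurable (extendOne (G := G) n) := by
  refine measurable_pi_lambda _ fun k => ?_
  unfold extendOne
  split_ifs
  · exact measurable_pi_apply _
  · exact measurable_const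

theorem walk_extendOne (n : ℕ) (ω : ℕ → G) :
    walk (extendOne n (Preorder.frestrictLe n ω)) (n + 1) = walk ω (n + 1) :=
  walk_congr fun k hk => by simp [extendOne, Nat.lt_succ_iff.1 hk]

variable [MeasurableSpace G] [DiscreteMeasurableSpace G]

-- Write `h` as a word of length `L` in the support. By the second Borel–Cantelli lemma, this word
-- almost surely occurs in one of the disjoint blocks of `L` increments.
open ProbabilityTheory in
theorem ae_exists_walk_eq_mul (μ : Measure G) [IsProbabilityMeasure μ] {h : G}
    (hh : h ∈ Submonoid.closure {g : G | μ {g} ≠ 0}) :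
    ∀ᵐ ω ∂(Measure.infinitePi fun _ : ℕ => μ), ∃ m n, walk ω n = walk ω m * h := by
  obtain ⟨u, L, hu, rfl⟩ := exists_walk_eq_of_mem_closure hh
  -- Prescribing the increments periodically makes `A i` the event that block `i` spells the word;
  -- for `L = 0` every block is empty.
  let t : ℕ → Set G := fun n => {u (n % L)}
  let block : ℕ → Finset ℕ := fun i => Finset.Ico (i * L) (i * L + L)
  let A : ℕ → Set (ℕ → G) := fun i => Set.pi (block i) t
  have hdisj : Pairwise (Function.onFun Disjoint block) := by
    have key : ∀ i j, i < j → Disjoint (block i) (block j) := by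
      intro i j hij
      rw [Finset.disjoint_left]
      intro n hn hn'
      simp only [block, Finset.mem_Ico] at hn hn'
      have : (i + 1) * L ≤ j * L := Nat.mul_le_mul_right _ hij
      rw [add_mul] at this
      omega
    intro i j hij
    rcases lt_or_gt_of_ne hij with h | h
    · exact key i j h
    · exact (key j i h).symm
  have hAm : ∀ i, MeasurableSet (A i) := fun i =>
    MeasurableSet.pi (block i).countable_toSet fun n _ => MeasurableSet.of_discrete
  have hP : ∀ s : Finset ℕ, Measure.infinitePi (fun _ : ℕ => μ) (Set.pi s t) =
      ∏ n ∈ s, μ (t n) := fun s => Measure.infinitePi_pi _ fun n _ => MeasurableSet.of_discrete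
  have hind : iIndepSet A (Measure.infinitePi fun _ : ℕ => μ) := by
    rw [iIndepSet_iff_meas_biInter hAm]
    intro s
    have : ⋂ i ∈ s, A i = Set.pi (s.biUnion block : Finset ℕ) t := by
      ext ω
      simp only [A, Set.mem_iInter, Set.mem_pi, Finset.mem_coe, Finset.mem_biUnion]
      grind
    rw [this, hP, Finset.prod_biUnion fun i _ j _ hij => hdisj hij]
    exact Finset.prod_congr rfl fun i _ => (hP _).symm
  have hval : ∀ i, Measure.infinitePi (fun _ : ℕ => μ) (A i) = ∏ k ∈ Finset.range L, μ {u k} := by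
    intro i
    rw [hP, Finset.prod_Ico_eq_prod_range]
    simp only [add_tsub_cancel_left]
    refine Finset.prod_congr rfl fun k hk => ?_
    simp only [t]
    rw [mul_comm, Nat.mul_add_mod, Nat.mod_eq_of_lt (Finset.mem_range.1 hk)]
  have hone := measure_limsup_eq_one hAm hind (by
    simp_rw [hval]
    exact ENNReal.tsum_const_eq_top_of_ne_zero
      (Finset.prod_ne_zero_iff.2 fun k hk => hu k (Finset.mem_range.1 hk)))
  have hae : ∀ᵐ ω ∂(Measure.infinitePi fun _ : ℕ => μ), ω ∈ limsup A atTop :=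
    (mem_ae_iff_prob_eq_one (MeasurableSet.measurableSet_limsup hAm)).2 hone
  filter_upwards [hae] with ω hω
  obtain ⟨i, hi⟩ := (mem_limsup_iff_frequently_mem.1 hω).exists
  refine ⟨i * L, i * L + L, ?_⟩
  rw [walk_add]
  congr 1
  refine walk_congr fun n hn => ?_
  have := hi (i * L + n) (by simpa [block] using hn)
  simpa [t, mul_comm i L, Nat.mul_add_mod, Nat.mod_eq_of_lt hn] using this

variable [Countable G]

theorem ae_infinite_range_walk [Infinite G] {μ : Measure G} [IsProbabilityMeasure μ]
    (hμ : IsGeneratingMeasure μ) :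
    ∀ᵐ ω ∂(Measure.infinitePi fun _ : ℕ => μ), (range (walk ω)).Infinite := by
  have hall : ∀ᵐ ω ∂(Measure.infinitePi fun _ : ℕ => μ),
      ∀ h : Submonoid.closure {g : G | μ {g} ≠ 0}, ∃ m n, walk ω n = walk ω m * (h : G) :=
    ae_all_iff.2 fun h => ae_exists_walk_eq_mul μ h.2
  filter_upwards [hall] with ω hω hfin
  -- A finite range would allow only finitely many quotients `(w_m)⁻¹ w_n`, yet these exhaust the
  -- infinite submonoid.
  refine infinite_submonoid_closure hμ
    ((hfin.image2 (fun x y => x⁻¹ * y) hfin).subset fun h hh => ?_)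
  obtain ⟨m, n, hmn⟩ := hω ⟨h, hh⟩
  exact ⟨_, mem_range_self m, _, mem_range_self n, by simp [hmn]⟩

theorem measurable_walk (n : ℕ) : Measurable fun ω : ℕ → G => walk ω n := by
  induction n with
  | zero => exact measurable_const
  | succ n ih =>
    exact (measurable_of_countable fun p : G × G => p.1 * p.2).comp
      (ih.prodMk (measurable_pi_apply n))

/-- The shift to `n + 1` matches the filtration: at time `n` it sees `ω 0, …, ω n`, which determine
the position `walk ω (n + 1)`. -/
theorem martingale_harmonic_walk (μ : Measure G) [IsProbabilityMeasure μ] {F : G → ℝ} {C : ℝ}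
    (hC : ∀ g, |F g| ≤ C) (hF : ∀ g, ∫ h, F (g * h) ∂μ = F g) :
    Martingale (fun (n : ℕ) (ω : ℕ → G) => F (walk ω (n + 1)))
      (Filtration.piLE (X := fun _ : ℕ => G)) (Measure.infinitePi fun _ : ℕ => μ) := by
  have hFm : Measurable F := measurable_of_countable F
  have hint : ∀ n, Integrable (fun ω : ℕ → G => F (walk ω n)) (Measure.infinitePi fun _ => μ) :=
    fun n => Integrable.of_bound (hFm.comp (measurable_walk n)).aestronglyMeasurable C
      (Eventually.of_forall fun ω => hC _)
  have hwe : ∀ n, Measurable fun v : Finset.Iic n → G => F (walk (extendOne n v) (n + 1)) :=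
    fun n => hFm.comp ((measurable_walk (n + 1)).comp (measurable_extendOne n))
  refine martingale_of_setIntegral_eq_succ (fun n => ?_) (fun n => hint _) fun n s hs => ?_
  · refine Measurable.stronglyMeasurable ?_
    rw [Filtration.piLE_eq_comap_frestrictLe]
    have h := (hwe n).comp (comap_measurable (Preorder.frestrictLe n : (ℕ → G) → _))
    simpa only [Function.comp_def, walk_extendOne] using h
  · rw [Filtration.piLE_eq_comap_frestrictLe] at hs
    obtain ⟨t, ht, rfl⟩ := hs
    have hr : Measurable (Preorder.frestrictLe n : (ℕ → G) → _) := by fun_prop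
    -- By independence the next step is integrated against a product with `μ`; after Fubini the
    -- inner integral is the harmonicity of `F`.
    let Φ : (Finset.Iic n → G) × G → ℝ := fun p =>
      t.indicator (fun v => F (walk (extendOne n v) (n + 1) * p.2)) p.1
    have hΦ : Measurable Φ := by
      refine measurable_from_prod_countable_left fun g => ?_
      exact Measurable.indicator ((measurable_of_countable fun x => F (x * g)).comp
        ((measurable_walk (n + 1)).comp (measurable_extendOne n))) ht
    have hΦint : Integrable Φ
        (((Measure.infinitePi fun _ : ℕ => μ).map (Preorder.frestrictLe n)).prod μ) := by
      have := Measure.isProbabilityMeasure_map (μ := Measure.infinitePi fun _ : ℕ => μ)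
        hr.aemeasurable
      refine Integrable.of_bound hΦ.aestronglyMeasurable C (Eventually.of_forall fun p => ?_)
      exact (norm_indicator_le_norm_self _ _).trans (hC _)
    have hsucc : ∫ ω in Preorder.frestrictLe n ⁻¹' t, F (walk ω (n + 1 + 1))
        ∂(Measure.infinitePi fun _ => μ) = ∫ p, Φ p
          ∂(((Measure.infinitePi fun _ : ℕ => μ).map (Preorder.frestrictLe n)).prod μ) := by
      rw [← map_frestrictLe_prod_eval, integral_map (by fun_prop) hΦ.aestronglyMeasurable,
        ← integral_indicator (hr ht)]
      congr! 2 with ω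
      by_cases hω : Preorder.frestrictLe n ω ∈ t
      · simp only [Φ, Set.indicator_of_mem hω, walk_extendOne]
        rw [Set.indicator_of_mem (by exact hω), walk]
      · simp only [Φ, Set.indicator_of_notMem hω]
        rw [Set.indicator_of_notMem (by exact hω)]
    rw [hsucc, integral_prod _ hΦint, integral_map hr.aemeasurable
      hΦint.integral_prod_left.aestronglyMeasurable, ← integral_indicator (hr ht)]
    congr! 2 with ω
    by_cases hω : Preorder.frestrictLe n ω ∈ t
    · simp only [Φ, Set.indicator_of_mem hω, walk_extendOne]
      rw [Set.indicator_of_mem (by exact hω), hF]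
    · simp only [Φ, Set.indicator_of_notMem hω]
      rw [Set.indicator_of_notMem (by exact hω), integral_zero]

theorem ae_exists_tendsto_harmonic_walk (μ : Measure G) [IsProbabilityMeasure μ] {F : G → ℝ}
    {C : ℝ} (hC : ∀ g, |F g| ≤ C) (hF : ∀ g, ∫ h, F (g * h) ∂μ = F g) :
    ∀ᵐ ω ∂(Measure.infinitePi fun _ : ℕ => μ),
      ∃ c, Tendsto (fun n => F (walk ω n)) atTop (𝓝 c) := by
  have h := (martingale_harmonic_walk μ hC hF).submartingale.exists_ae_tendsto_of_bdd
    (R := C.toNNReal) fun n => by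
      refine (eLpNorm_le_of_ae_bound (C := C) (Eventually.of_forall fun ω => hC _)).trans ?_
      simp [ENNReal.ofReal]
  filter_upwards [h] with ω hω
  obtain ⟨c, hc⟩ := hω
  exact ⟨c, (tendsto_add_atTop_iff_nat 1).1 hc⟩

end Walk

/-! ### From convergence of the integrals to convergence of the path. -/

theorem dist_le_diam_univ {M : Type*} [MetricSpace M] [CompactSpace M] (x y : M) : dist x y ≤ Metric.diam (univ : Set M) :=
  Metric.dist_le_diam_of_mem isCompact_univ.isBounded (mem_univ x) (mem_univ y)

section Limit

variable {G M : Type*} [Group G] [MetricSpace M] [CompactSpace M] [MeasurableSpace M]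
  [BorelSpace M] [MulAction G M] [ContinuousConstSMul G M]

theorem tendsto_integral_dist {ν : Measure M} [IsProbabilityMeasure ν] (hν : ∀ x, ν {x} = 0)
    {h : ℕ → G} {a b : M} (hab : ∀ x, x ≠ a → Tendsto (fun k => h k • x) atTop (𝓝 b)) (y : M) :
    Tendsto (fun k => ∫ x, dist (h k • x) y ∂ν) atTop (𝓝 (dist b y)) := by
  have hlim := tendsto_integral_of_dominated_convergence (μ := ν)
    (F := fun k x => dist (h k • x) y) (f := fun _ => dist b y)
    (fun _ => Metric.diam (univ : Set M))
    (fun k => ((continuous_const_smul (h k)).dist continuous_const).measurable.aestronglyMeasurable)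
    (integrable_const _)
    (fun k => Eventually.of_forall fun x => by
      simpa [abs_of_nonneg dist_nonneg] using dist_le_diam_univ _ _)
    (by
      filter_upwards [compl_mem_ae_iff.2 (hν a)] with x hx using
        (hab x (by simpa using hx)).dist tendsto_const_nhds)
  simpa using hlim

theorem continuous_integral_dist (ν : Measure M) [IsProbabilityMeasure ν] (g : G) :
    Continuous fun y : M => ∫ x, dist (g • x) y ∂ν :=
  continuous_of_dominated (bound := fun _ => Metric.diam (univ : Set M))
    (fun _ => ((continuous_const_smul g).dist
      continuous_const).measurable.aestronglyMeasurable)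
    (fun y => Eventually.of_forall fun x => by
      simpa [abs_of_nonneg dist_nonneg] using dist_le_diam_univ _ _)
    (integrable_const _) (Eventually.of_forall fun x => continuous_const.dist continuous_id)

theorem exists_tendsto_inr_of_tendsto_integral_dist [Nonempty M] (hconv : IsConvergenceAction G M)
    {ν : Measure M} [IsProbabilityMeasure ν] (hν : ∀ x, ν {x} = 0) {w : ℕ → G}
    (hw : (range w).Infinite)
    (hlim : ∀ i, ∃ c, Tendsto (fun n => ∫ x, dist (w n • x) (TopologicalSpace.denseSeq M i) ∂ν)
      atTop (𝓝 c)) :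
    ∃ p : M, ∀ x : DistinctTriples M,
      Tendsto (fun n => (Sum.inl (w n) : G ⊕ M)) atTop (@nhds _ (tripleTopology G x) (Sum.inr p)) := by
  choose c hc using hlim
  -- The limits `c i` are the distances from any attracting point to the dense sequence. The times
  -- `m k` need not increase, but injectivity sends them to infinity.
  have hval : ∀ (h : ℕ → G), Function.Injective h → (∀ k, h k ∈ range w) → ∀ a b : M,
      (∀ x, x ≠ a → Tendsto (fun k => h k • x) atTop (𝓝 b)) →
      ∀ i, c i = dist b (TopologicalSpace.denseSeq M i) := by
    intro h hinj hmem a b hab i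
    choose m hm using hmem
    have hmi : Function.Injective m := fun k l hkl => hinj (by rw [← hm k, ← hm l, hkl])
    refine tendsto_nhds_unique ((hc i).comp hmi.nat_tendsto_atTop) ?_
    simpa only [Function.comp_def, hm] using
      tendsto_integral_dist hν hab (TopologicalSpace.denseSeq M i)
  obtain ⟨h, hinj, hmem, a, p, hab⟩ := hconv.exists_tendsto hw
  have hp := hval h hinj hmem a p hab
  -- If `g` recurred infinitely often, `∫ dist (g • x) y ∂ν` would equal `dist p y` for every `y`.
  -- At `y = p` this puts all the mass of `ν` at `g⁻¹ • p`, an atom.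
  have hcof : ∀ g : G, {n | w n = g}.Finite := by
    intro g
    by_contra hinf
    have hfreq : ∃ᶠ n in atTop, w n = g := Nat.frequently_atTop_iff_infinite.2 hinf
    obtain ⟨φ, hφ, hφg⟩ := extraction_of_frequently_atTop hfreq
    have heq : (fun y : M => ∫ x, dist (g • x) y ∂ν) = fun y => dist p y := by
      refine (TopologicalSpace.denseRange_denseSeq M).equalizer (continuous_integral_dist ν g)
        (continuous_const.dist continuous_id) (funext fun i => ?_)
      have := (hc i).comp hφ.tendsto_atTop
      simp only [Function.comp_def, hφg] at this
      exact (tendsto_nhds_unique tendsto_const_nhds this).trans (hp i)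
    have h0 : ∫ x, dist (g • x) p ∂ν = 0 := by simpa using congrFun heq p
    have hae : (fun x => dist (g • x) p) =ᵐ[ν] 0 :=
      (integral_eq_zero_iff_of_nonneg (fun _ => dist_nonneg)
        (Integrable.of_bound ((continuous_const_smul g).dist
          continuous_const).measurable.aestronglyMeasurable (Metric.diam (univ : Set M))
          (Eventually.of_forall fun x => by
            simpa [abs_of_nonneg dist_nonneg] using dist_le_diam_univ _ _))).1 h0
    have hne : ∀ᵐ x ∂ν, x ≠ g⁻¹ • p := compl_mem_ae_iff.2 (hν _)
    obtain ⟨x, hx1, hx2⟩ := (hae.and hne).exists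
    exact hx2 (eq_inv_smul_iff.2 (dist_eq_zero.1 hx1))
  refine ⟨p, fun x => (tendsto_nhds_inr_iff x).2 fun U hU hpU => ?_⟩
  simp only [inl_mem_tildeSet]
  by_contra hcon
  have hinf : {n | w n ∉ pairSet G x U}.Infinite := Nat.frequently_atTop_iff_infinite.1 (not_eventually.1 hcon)
  -- Infinitely many bad times give infinitely many distinct positions, hence an attracting point
  -- `p'`. Its distances to the dense sequence are those of `p`, so `p' = p`, a contradiction.
  have hA : (w '' {n | w n ∉ pairSet G x U}).Infinite := fun hfin =>
    hinf ((hfin.biUnion fun g _ => hcof g).subset fun n hn =>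
      Set.mem_biUnion (mem_image_of_mem w hn) rfl)
  obtain ⟨h', hinj', hmem', a', p', hab'⟩ := hconv.exists_tendsto hA
  have hp' := hval h' hinj' (fun k => image_subset_range _ _ (hmem' k)) a' p' hab'
  have hpp : (fun y : M => dist p y) = fun y => dist p' y :=
    (TopologicalSpace.denseRange_denseSeq M).equalizer (continuous_const.dist continuous_id)
      (continuous_const.dist continuous_id) (funext fun i => (hp i).symm.trans (hp' i))
  obtain rfl : p' = p := dist_eq_zero.1 (by simpa using (congrFun hpp p).symm)
  obtain ⟨k, hk⟩ := (eventually_mem_pairSet hab' x (hU.mem_nhds hpU)).exists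
  obtain ⟨n, hn, hn'⟩ := hmem' k
  exact hn (hn' ▸ hk)

/-- Stationarity tested on `x ↦ dist (g • x) y`, followed by Fubini. -/
theorem integral_harmonic [Countable G] [MeasurableSpace G] [DiscreteMeasurableSpace G]
    {μ : Measure G} [IsProbabilityMeasure μ] {ν : Measure M} [IsProbabilityMeasure ν]
    (hν : convAction μ ν = ν) (y : M) (g : G) :
    ∫ h, ∫ x, dist ((g * h) • x) y ∂ν ∂μ = ∫ x, dist (g • x) y ∂ν := by
  let f : BoundedContinuousFunction M ℝ := BoundedContinuousFunction.mkOfCompact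
    ⟨fun x => dist (g • x) y, (continuous_const_smul g).dist continuous_const⟩
  have h1 := integral_convAction μ ν f
  rw [hν, integral_integral_swap (f := fun x g => f (g • x))
    (integrable_boundedContinuousFunction_smul μ ν f).swap] at h1
  simpa [f, mul_smul] using h1.symm

end Limit

/-! ### Assembly. -/

theorem ae_exists_tendsto_walk {G M : Type*} [Group G] [Countable G] [Infinite G]
    [MeasurableSpace G] [DiscreteMeasurableSpace G]
    [TopologicalSpace M] [CompactSpace M] [TopologicalSpace.MetrizableSpace M]
    [MulAction G M] [ContinuousConstSMul G M]
    (hconv : IsConvergenceAction G M) (hne : IsNonElementaryAction G M)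
    (hmin : MulAction.IsMinimal G M) {μ : Measure G} [IsProbabilityMeasure μ]
    (hμ : IsGeneratingMeasure μ) :
    ∀ᵐ ω ∂(Measure.infinitePi fun _ : ℕ => μ), ∃ p : M, ∀ x : DistinctTriples M,
      Tendsto (fun n => (Sum.inl (walk ω n) : G ⊕ M)) atTop
        (@nhds _ (tripleTopology G x) (Sum.inr p)) := by
  have := hconv.infinite hne
  let := TopologicalSpace.metrizableSpaceMetric M
  let : MeasurableSpace M := borel M
  have : BorelSpace M := ⟨rfl⟩
  obtain ⟨ν, _, hν⟩ := exists_stationary (M := M) μ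
  have hatom := measure_singleton_of_stationary hmin hμ hν
  have hlim : ∀ᵐ ω ∂(Measure.infinitePi fun _ : ℕ => μ), ∀ i, ∃ c, Tendsto
      (fun n => ∫ x, dist (walk ω n • x) (TopologicalSpace.denseSeq M i) ∂ν) atTop (𝓝 c) :=
    ae_all_iff.2 fun i => ae_exists_tendsto_harmonic_walk μ
      (F := fun g => ∫ x, dist (g • x) (TopologicalSpace.denseSeq M i) ∂ν)
      (C := Metric.diam (univ : Set M))
      (fun g => by
        simpa using norm_integral_le_of_norm_le_const (μ := ν)
          (f := fun x => dist (g • x) (TopologicalSpace.denseSeq M i))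
          (C := Metric.diam (univ : Set M)) (Eventually.of_forall fun x => by
            simpa [abs_of_nonneg dist_nonneg] using
              dist_le_diam_univ (g • x) (TopologicalSpace.denseSeq M i)))
      (integral_harmonic hν _)
  filter_upwards [hlim, ae_infinite_range_walk hμ] with ω h1 h2
  exact exists_tendsto_inr_of_tendsto_integral_dist hconv hatom h2 h1

theorem theorem1p1 {G M : Type*} [Group G] [Countable G] [Infinite G]
    [TopologicalSpace G] [DiscreteTopology G] [MeasurableSpace G] [DiscreteMeasurableSpace G]
    [TopologicalSpace M] [CompactSpace M] [TopologicalSpace.MetrizableSpace M]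
    [MulAction G M] [ContinuousConstSMul G M]
    (hconv : IsConvergenceAction G M) (hne : IsNonElementaryAction G M)
    (hmin : MulAction.IsMinimal G M) :
    ∃ τ : TopologicalSpace (G ⊕ M),
      (Nonempty (DistinctTriples M) ∧ ∀ x : DistinctTriples M, τ = tripleTopology G x) ∧
      @CompactSpace (G ⊕ M) τ ∧ @T2Space (G ⊕ M) τ ∧
      @IsEmbedding G (G ⊕ M) _ τ Sum.inl ∧ @IsEmbedding M (G ⊕ M) _ τ Sum.inr ∧
      ∀ μ : Measure G, IsProbabilityMeasure μ → IsGeneratingMeasure μ →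
        ∀ᵐ ω ∂(Measure.infinitePi fun _ : ℕ => μ),
          ∃ p : M, Tendsto (fun n => (Sum.inl (walk ω n) : G ⊕ M)) atTop (@nhds _ τ (Sum.inr p)) := by
  have := hconv.infinite hne
  obtain ⟨x⟩ := nonempty_distinctTriples (M := M)
  have hT2 := t2Space_tripleTopology (G := G) x
  refine ⟨tripleTopology G x, ⟨⟨x⟩, fun y => (tripleTopology_le hconv x y).antisymm
    (tripleTopology_le hconv y x)⟩, compactSpace_tripleTopology hconv x, hT2, ?_, ?_, ?_⟩
  · let := tripleTopology G x
    refine ⟨⟨?_⟩, Sum.inl_injective⟩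
    rw [DiscreteTopology.eq_bot (α := G)]
    refine (eq_bot_of_singletons_open fun g => ?_).symm
    exact ⟨Sum.inl '' {g}, isOpen_inl_image x _, Set.preimage_image_eq _ Sum.inl_injective⟩
  · let := tripleTopology G x
    exact ((continuous_inr_tripleTopology x).isClosedEmbedding Sum.inr_injective).isEmbedding
  · intro μ _ hμ
    filter_upwards [ae_exists_tendsto_walk hconv hne hmin hμ] with ω ⟨p, hp⟩ using ⟨p, hp x⟩
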